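/- Let $\sigma\ge 0$, $P\ge 0$. For a blocklength $m\ge 1$ and a rate $R\ge 0$, let the host signal $\mathbf X_0\sim\mathcal N(0,\sigma^2 I_m)$, the channel noise $\mathbf Z\sim\mathcal N(0,I_m)$ and the message $M$, uniform on $\{1,\dots,\lfloor 2^{mR}\rfloor\}$, be mutually independent. An encoder $\mathcal E_m$ is a (measurable) map $(M,\mathbf X_0)\mapsto\mathbf X_1\in\mathbb R^m$ that satisfies, for each value of the message, the power constraint $\mathbb E\|\mathbf X_0-\mathbf X_1\|^2\le mP$. A decoder $\mathcal D_m$ is a (measurable) map that sends $\mathbf Y=\mathbf X_1+\mathbf Z$ to a pair $(\widehat{\mathbf X}_1,\widehat M)$ consisting of estimates of $\mathbf X_1$ and of $M$. Put $d(\mathbf x,\mathbf y)=\frac1m\|\mathbf x-\mathbf y\|^2$ (Euclidean norm) and $$\mathrm{MMSE}(P,R)=\inf\ \limsup_{m\to\infty}\ \mathbb E\,d(\mathbf X_1,\widehat{\mathbf X}_1),$$ where the infimum is over all sequences $\{\mathcal E_m,\mathcal D_m\}_{m\ge1}$ of such encoders and decoders with $\Pr(M\ne\widehat M)\to0$. For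 $R=0$ (the vector Witsenhausen counterexample) there is only one message. Let $$L(\sigma,P)=\inf_{|\sigma_{XV}|\le\sigma\sqrt P}\ \sup_{\gamma\in\mathbb R\setminus\{0\}}\ \frac1{\gamma^2}\left(\left(\sqrt{\frac{\sigma^2}{1+\sigma^2+P+2\sigma_{XV}}}-\sqrt{(1-\gamma)^2\sigma^2+\gamma^2P-2\gamma(1-\gamma)\sigma_{XV}}\right)^+\right)^2,$$ where $x^+=\max(x,0)$. Then $$\mathrm{MMSE}(P,0)\ \ge\ L(\sigma,P).$$ Further, the bound holds at every blocklength and not just asymptotically: for every $m\ge1$ and every encoder-decoder pair $(\mathcal E_m,\mathcal D_m)$ at rate $R=0$ that satisfies the power constraint, $\mathbb E\,d(\mathbf X_1,\widehat{\mathbf X}_1)\ge L(\sigma,P)$. -/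

import Mathlib

open MeasureTheory ProbabilityTheory Filter Topology
open scoped NNReal ENNReal

noncomputable section

namespace InfoEmbedding

/-- White Gaussian law `N(0, v I)` on `ℝ^m` (`v` is the variance of each coordinate). -/
def whiteGaussian (m : ℕ) (v : ℝ≥0) : Measure (Fin m → ℝ) :=
  Measure.pi fun _ => gaussianReal 0 v

/-- Squared Euclidean distance `‖x - y‖²` on `ℝ^m`. -/
def sqDist {m : ℕ} (x y : Fin m → ℝ) : ℝ := ∑ i, (x i - y i) ^ 2

/-- Number of messages `2^{mR}` at blocklength `m` and rate `R` (rounded down when it is not an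
integer; it equals `1` when `R = 0`). -/
def numMessages (m : ℕ) (R : ℝ) : ℕ := ⌊(2 : ℝ) ^ ((m : ℝ) * R)⌋₊

/-- An encoder-decoder pair of blocklength `m` with `N` messages.  The encoder maps the message and
the host signal to the modified host signal; the decoder maps the channel output to an estimate of
the modified host signal and an estimate of the message. -/
structure Code (m N : ℕ) where
  encode : Fin N → (Fin m → ℝ) → (Fin m → ℝ)
  measurable_encode : ∀ k, Measurable (encode k)
  decodeHost : (Fin m → ℝ) → (Fin m → ℝ)
  measurable_decodeHost : Measurable decodeHost
  decodeMsg : (Fin m → ℝ) → Fin N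
  measurable_decodeMsg : Measurable decodeMsg

/-- Joint law of `(M, X₀, Z)`: uniform message, host `N(0, σ² I)`, channel noise `N(0, I)`,
mutually independent. -/
def sourceLaw (m N : ℕ) (σ : ℝ≥0) : Measure (Fin N × (Fin m → ℝ) × (Fin m → ℝ)) :=
  (uniformOn (Set.univ : Set (Fin N))).prod ((whiteGaussian m (σ ^ 2)).prod (whiteGaussian m 1))

namespace Code

variable {m N : ℕ}

/-- The modified host signal `X₁`, as a function of `(M, X₀, Z)`. -/
def modifiedHost (c : Code m N) (ω : Fin N × (Fin m → ℝ) × (Fin m → ℝ)) : Fin m → ℝ :=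
  c.encode ω.1 ω.2.1

/-- The channel output `Y = X₁ + Z`, as a function of `(M, X₀, Z)`. -/
def channelOutput (c : Code m N) (ω : Fin N × (Fin m → ℝ) × (Fin m → ℝ)) : Fin m → ℝ :=
  c.modifiedHost ω + ω.2.2

/-- For each message, the input `V = X₁ - X₀` satisfies `E ‖X₀ - X₁‖² ≤ m P`. -/
def PowerConstraint (c : Code m N) (σ P : ℝ≥0) : Prop :=
  ∀ k : Fin N,
    ∫⁻ x₀, ENNReal.ofReal (sqDist x₀ (c.encode k x₀)) ∂(whiteGaussian m (σ ^ 2))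
      ≤ (m : ℝ≥0∞) * (P : ℝ≥0∞)

/-- Error probability `Pr(M ≠ M̂)`. -/
def errorProb (c : Code m N) (σ : ℝ≥0) : ℝ≥0∞ :=
  sourceLaw m N σ {ω | ω.1 ≠ c.decodeMsg (c.channelOutput ω)}

/-- Average distortion `E d(X₁, X̂₁) = (1/m) E ‖X₁ - X̂₁‖²`, possibly `∞`. -/
def distortion (c : Code m N) (σ : ℝ≥0) : ℝ≥0∞ :=
  (∫⁻ ω, ENNReal.ofReal (sqDist (c.modifiedHost ω) (c.decodeHost (c.channelOutput ω)))
    ∂(sourceLaw m N σ)) / (m : ℝ≥0∞)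

end Code

/-- Minimum asymptotic distortion `MMSE(P, R)`: infimum, over sequences of codes of rate `R` that
meet the power constraint and whose error probability tends to `0`, of the limit superior of the
average distortion.  (The term of index `m = 0` of a sequence plays no role.) -/
def MMSE (σ P : ℝ≥0) (R : ℝ) : ℝ≥0∞ :=
  ⨅ (c : (m : ℕ) → Code m (numMessages m R))
    (_ : ∀ m, (c m).PowerConstraint σ P)
    (_ : Tendsto (fun m => (c m).errorProb σ) atTop (𝓝 0)),
    limsup (fun m => (c m).distortion σ) atTop

/-- The function whose sup over `γ` and inf over `s = σ_XV` is the lower bound. -/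
def boundTerm (σ P : ℝ≥0) (s γ : ℝ) : ℝ :=
  1 / γ ^ 2 *
    (max (√((σ : ℝ) ^ 2 / (1 + (σ : ℝ) ^ 2 + P + 2 * s))
      - √((1 - γ) ^ 2 * (σ : ℝ) ^ 2 + γ ^ 2 * P - 2 * γ * (1 - γ) * s)) 0) ^ 2

/-- `inf_{|s| ≤ σ √P} sup_γ boundTerm`, with values in `[0, ∞]`.  The supremum is over `γ ≠ 0`; at
`γ = 0` the positive part in `boundTerm` vanishes for every admissible `s`. -/
def lowerBound (σ P : ℝ≥0) : ℝ≥0∞ :=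
  ⨅ (s : ℝ) (_ : |s| ≤ (σ : ℝ) * √(P : ℝ)), ⨆ (γ : ℝ) (_ : γ ≠ 0),
    ENNReal.ofReal (boundTerm σ P s γ)

end InfoEmbedding

end

noncomputable section

namespace InfoEmbedding

-- Second moments of random vectors: Cauchy-Schwarz and Minkowski.

section SecondMoments

variable {Ω : Type*} [MeasurableSpace Ω] {μ : Measure Ω} {m : ℕ}

-- Let X₁ = f(X₀) and X̂₁ = g(X₁ + Z). For γ ≠ 0, view γX̂₁ as an estimate of the host: X₀ - γX̂₁ =
-- ((1-γ)X₀ + γ(X₀ - X₁)) + γ(X₁ - X̂₁). Minkowski (`sqrt_integral_sum_sq_linComb_le`) bounds its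
-- rms by that of the bracket, controlled by σ², P and σ_XV, plus |γ| times the rms of the
-- distortion. From below, `variance_div_le_integral_sum_sq_sub` gives σ²/T with T = 1 + σ² + P +
-- 2σ_XV. Solving for the distortion yields `boundTerm` for every γ; σ_XV is fixed by the code
-- before γ is chosen, hence the infimum outside the supremum.
--
-- The converse is "rate-distortion ≤ capacity", proved without mutual information. The law of (X₀,
-- Z) is compared with a Gaussian backward test channel; the density ratio has mean one
-- (`lintegral_backward_density_ratio`), so its logarithm has mean at most zero
-- (`integral_nonpos_of_lintegral_exp_le_one`). The moment bounds reduce this to log(σ²/(dT)) ≤ 0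
-- for each d above the mean squared error.

theorem integrable_sum_sq {u : Ω → Fin m → ℝ} (hu : ∀ i, MemLp (fun ω => u ω i) 2 μ) :
    Integrable (fun ω => ∑ i, u ω i ^ 2) μ :=
  integrable_finsetSum _ fun i _ => (hu i).integrable_sq

theorem integrable_sum_mul {u v : Ω → Fin m → ℝ} (hu : ∀ i, MemLp (fun ω => u ω i) 2 μ)
    (hv : ∀ i, MemLp (fun ω => v ω i) 2 μ) :
    Integrable (fun ω => ∑ i, u ω i * v ω i) μ :=
  integrable_finsetSum _ fun i _ => (hu i).integrable_mul (hv i)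

/-- Expansion of the second moment of a linear combination of two random vectors. -/
theorem integral_sum_sq_linComb {u v : Ω → Fin m → ℝ} (hu : ∀ i, MemLp (fun ω => u ω i) 2 μ)
    (hv : ∀ i, MemLp (fun ω => v ω i) 2 μ) (a b : ℝ) :
    ∫ ω, ∑ i, (a * u ω i + b * v ω i) ^ 2 ∂μ
      = a ^ 2 * ∫ ω, ∑ i, u ω i ^ 2 ∂μ + 2 * a * b * ∫ ω, ∑ i, u ω i * v ω i ∂μ
        + b ^ 2 * ∫ ω, ∑ i, v ω i ^ 2 ∂μ := by
  have h : ∀ ω, ∑ i, (a * u ω i + b * v ω i) ^ 2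
      = a ^ 2 * ∑ i, u ω i ^ 2 + 2 * a * b * ∑ i, u ω i * v ω i + b ^ 2 * ∑ i, v ω i ^ 2 := by
    intro ω
    simp only [Finset.mul_sum, ← Finset.sum_add_distrib]
    exact Finset.sum_congr rfl fun i _ => by ring
  simp only [h]
  have h1 := (integrable_sum_sq hu).const_mul (a ^ 2)
  have h2 := (integrable_sum_mul hu hv).const_mul (2 * a * b)
  have h3 := (integrable_sum_sq hv).const_mul (b ^ 2)
  have h12 : Integrable (fun ω => a ^ 2 * ∑ i, u ω i ^ 2 + 2 * a * b * ∑ i, u ω i * v ω i) μ :=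
    h1.add h2
  rw [integral_add h12 h3, integral_add h1 h2]
  simp only [integral_const_mul]

theorem integral_sum_sq_nonneg (u : Ω → Fin m → ℝ) : 0 ≤ ∫ ω, ∑ i, u ω i ^ 2 ∂μ :=
  integral_nonneg fun ω => Finset.sum_nonneg fun i _ => sq_nonneg (u ω i)

/-- Cauchy-Schwarz inequality for random vectors. -/
theorem sq_integral_sum_mul_le {u v : Ω → Fin m → ℝ} (hu : ∀ i, MemLp (fun ω => u ω i) 2 μ)
    (hv : ∀ i, MemLp (fun ω => v ω i) 2 μ) :
    (∫ ω, ∑ i, u ω i * v ω i ∂μ) ^ 2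
      ≤ (∫ ω, ∑ i, u ω i ^ 2 ∂μ) * ∫ ω, ∑ i, v ω i ^ 2 ∂μ := by
  -- The second moment of t u + v is a nonnegative quadratic in t, so its discriminant is
  -- nonpositive.
  have h : ∀ t : ℝ, 0 ≤ (∫ ω, ∑ i, u ω i ^ 2 ∂μ) * (t * t)
      + (2 * ∫ ω, ∑ i, u ω i * v ω i ∂μ) * t + ∫ ω, ∑ i, v ω i ^ 2 ∂μ := by
    intro t
    have h0 := integral_sum_sq_nonneg (μ := μ) fun ω i => t * u ω i + 1 * v ω i
    rw [integral_sum_sq_linComb hu hv] at h0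
    linarith
  have hd := discrim_le_zero h
  rw [discrim] at hd
  linarith

/-- Minkowski inequality for random vectors. -/
theorem sqrt_integral_sum_sq_linComb_le {u v : Ω → Fin m → ℝ}
    (hu : ∀ i, MemLp (fun ω => u ω i) 2 μ) (hv : ∀ i, MemLp (fun ω => v ω i) 2 μ) (b : ℝ) :
    √(∫ ω, ∑ i, (1 * u ω i + b * v ω i) ^ 2 ∂μ)
      ≤ √(∫ ω, ∑ i, u ω i ^ 2 ∂μ) + |b| * √(∫ ω, ∑ i, v ω i ^ 2 ∂μ) := by
  have hA := integral_sum_sq_nonneg (μ := μ) u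
  have hC := integral_sum_sq_nonneg (μ := μ) v
  refine Real.sqrt_le_iff.2 ⟨by positivity, ?_⟩
  rw [integral_sum_sq_linComb hu hv, add_sq, mul_pow, Real.sq_sqrt hA, Real.sq_sqrt hC, sq_abs]
  have hcs := Real.abs_le_sqrt (sq_integral_sum_mul_le hu hv)
  rw [Real.sqrt_mul hA] at hcs
  have hb : b * ∫ ω, ∑ i, u ω i * v ω i ∂μ
      ≤ |b| * (√(∫ ω, ∑ i, u ω i ^ 2 ∂μ) * √(∫ ω, ∑ i, v ω i ^ 2 ∂μ)) :=
    (le_abs_self _).trans ((abs_mul _ _).trans_le (by gcongr))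
  linarith

theorem integrable_of_lintegral_ofReal_ne_top {F : Ω → ℝ} (hF : Measurable F) (h0 : ∀ ω, 0 ≤ F ω)
    (h : ∫⁻ ω, ENNReal.ofReal (F ω) ∂μ ≠ ∞) : Integrable F μ :=
  ⟨hF.aestronglyMeasurable, by
    rw [hasFiniteIntegral_iff_ofReal (Eventually.of_forall h0)]; exact h.lt_top⟩

/-- Each squared coordinate is dominated by the sum; this passes from the `ℝ≥0∞`-valued definitions
to Bochner integrals. -/
theorem memLp_two_of_lintegral_ne_top {u : Ω → Fin m → ℝ} (hu : Measurable u)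
    (h : ∫⁻ ω, ENNReal.ofReal (∑ i, u ω i ^ 2) ∂μ ≠ ∞) (i : Fin m) :
    MemLp (fun ω => u ω i) 2 μ := by
  have hm : ∀ j, Measurable fun ω => u ω j := fun j => (measurable_pi_apply j).comp hu
  have hI : Integrable (fun ω => ∑ i, u ω i ^ 2) μ :=
    integrable_of_lintegral_ofReal_ne_top (Finset.measurable_sum _ fun j _ => (hm j).pow_const 2)
      (fun ω => Finset.sum_nonneg fun i _ => sq_nonneg _) h
  rw [memLp_two_iff_integrable_sq (hm i).aestronglyMeasurable]
  refine hI.mono ((hm i).pow_const 2).aestronglyMeasurable (Eventually.of_forall fun ω => ?_)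
  rw [Real.norm_of_nonneg (sq_nonneg _),
    Real.norm_of_nonneg (Finset.sum_nonneg fun i _ => sq_nonneg _)]
  exact Finset.single_le_sum (f := fun j => u ω j ^ 2) (fun j _ => sq_nonneg _) (Finset.mem_univ i)

end SecondMoments

-- White Gaussian law: density and moments.

section Gaussian

variable {m : ℕ}

instance isProbabilityMeasure_whiteGaussian (m : ℕ) (v : ℝ≥0) :
    IsProbabilityMeasure (whiteGaussian m v) := by
  unfold whiteGaussian; infer_instance

/-- Density of the white Gaussian law with respect to Lebesgue measure. -/
def whiteGaussianPDF (v : ℝ≥0) (x : Fin m → ℝ) : ℝ := ∏ i, gaussianPDFReal 0 v (x i)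

theorem measurable_whiteGaussianPDF (v : ℝ≥0) :
    Measurable (whiteGaussianPDF v : (Fin m → ℝ) → ℝ) :=
  Finset.measurable_prod _ fun i _ =>
    (measurable_gaussianPDFReal 0 v).comp (measurable_pi_apply i)

theorem whiteGaussianPDF_pos {v : ℝ≥0} (hv : v ≠ 0) (x : Fin m → ℝ) : 0 < whiteGaussianPDF v x :=
  Finset.prod_pos fun _ _ => gaussianPDFReal_pos _ _ _ hv

theorem log_whiteGaussianPDF {v : ℝ≥0} (hv : v ≠ 0) (x : Fin m → ℝ) :
    Real.log (whiteGaussianPDF v x)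
      = -(m / 2 * Real.log (2 * Real.pi * v)) - (∑ i, x i ^ 2) / (2 * v) := by
  have hv' : (0 : ℝ) < v := by positivity
  rw [whiteGaussianPDF, Real.log_prod fun i _ => (gaussianPDFReal_pos _ _ _ hv).ne']
  have h : ∀ t : ℝ, Real.log (gaussianPDFReal 0 v t)
      = -(1 / 2 * Real.log (2 * Real.pi * v)) - t ^ 2 / (2 * v) := by
    intro t
    rw [gaussianPDFReal, Real.log_mul (by positivity) (Real.exp_pos _).ne', Real.log_exp,
      Real.log_inv, Real.log_sqrt (by positivity)]
    ring
  simp only [h, Finset.sum_sub_distrib, Finset.sum_const, Finset.card_univ, Fintype.card_fin,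
    nsmul_eq_mul, Finset.sum_div]
  ring

theorem whiteGaussian_eq_withDensity {v : ℝ≥0} (hv : v ≠ 0) :
    whiteGaussian m v = volume.withDensity fun x => ENNReal.ofReal (whiteGaussianPDF v x) := by
  refine Measure.pi_eq fun s hs => ?_
  have hint : ∀ i, Integrable (gaussianPDFReal 0 v) (volume.restrict (s i)) :=
    fun i => (integrable_gaussianPDFReal 0 v).restrict
  rw [withDensity_apply _ (MeasurableSet.univ_pi hs), volume_pi, Measure.restrict_pi_pi,
    ← ofReal_integral_eq_lintegral_ofReal]
  · simp only [whiteGaussianPDF]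
    rw [integral_fintype_prod_eq_prod (fun _ => gaussianPDFReal 0 v),
      ENNReal.ofReal_prod_of_nonneg
        fun i _ => integral_nonneg fun x => gaussianPDFReal_nonneg 0 v x]
    exact Finset.prod_congr rfl fun i _ => (gaussianReal_apply_eq_integral 0 hv (s i)).symm
  · exact Integrable.fintype_prod_dep (f := fun _ => gaussianPDFReal 0 v) hint
  · exact Eventually.of_forall fun x => (whiteGaussianPDF_pos hv x).le

theorem lintegral_whiteGaussian {v : ℝ≥0} (hv : v ≠ 0) {F : (Fin m → ℝ) → ℝ≥0∞}
    (hF : Measurable F) :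
    ∫⁻ x, F x ∂whiteGaussian m v = ∫⁻ x, ENNReal.ofReal (whiteGaussianPDF v x) * F x := by
  rw [whiteGaussian_eq_withDensity hv, lintegral_withDensity_eq_lintegral_mul _
    (measurable_whiteGaussianPDF v).ennreal_ofReal hF]
  rfl

theorem lintegral_whiteGaussianPDF {v : ℝ≥0} (hv : v ≠ 0) :
    ∫⁻ x : Fin m → ℝ, ENNReal.ofReal (whiteGaussianPDF v x) = 1 := by
  have h := lintegral_whiteGaussian (m := m) hv (F := fun _ => 1) measurable_const
  simpa using h.symm

theorem memLp_eval_whiteGaussian (v : ℝ≥0) (i : Fin m) :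
    MemLp (fun x : Fin m → ℝ => x i) 2 (whiteGaussian m v) :=
  (memLp_id_gaussianReal (μ := 0) (v := v) 2).comp_measurePreserving
    (measurePreserving_eval (fun _ : Fin m => gaussianReal 0 v) i)

theorem integral_eval_whiteGaussian (v : ℝ≥0) (i : Fin m) :
    ∫ x, x i ∂whiteGaussian m v = 0 := by
  rw [whiteGaussian, integral_comp_eval (μ := fun _ : Fin m => gaussianReal 0 v) (f := fun t => t)
    measurable_id.aestronglyMeasurable, integral_id_gaussianReal]

theorem integral_sum_sq_whiteGaussian (v : ℝ≥0) :
    ∫ x, ∑ i, x i ^ 2 ∂whiteGaussian m v = m * v := by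
  rw [integral_finsetSum _ fun i _ => (memLp_eval_whiteGaussian v i).integrable_sq]
  have h : ∀ i : Fin m, ∫ x, x i ^ 2 ∂whiteGaussian m v = v := by
    intro i
    rw [whiteGaussian, integral_comp_eval (μ := fun _ : Fin m => gaussianReal 0 v)
      (f := fun t => t ^ 2) (by fun_prop)]
    have h1 := variance_id_gaussianReal (μ := 0) (v := v)
    rw [variance_of_integral_eq_zero aemeasurable_id (by simp)] at h1
    simpa using h1
  simp [h]

end Gaussian

-- Source-channel converse via the Gibbs inequality.

section Converse

variable {m : ℕ}

/-- The ratio of the density of the backward test channel `x = g y + N(0, D I)`, `y ∼ N(0, T I)`, to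
the joint density of source and channel noise has mean one. -/
theorem lintegral_backward_density_ratio {f g : (Fin m → ℝ) → Fin m → ℝ} (hf : Measurable f)
    (hg : Measurable g) {v D T : ℝ≥0} (hv : v ≠ 0) (hD : D ≠ 0) (hT : T ≠ 0) :
    ∫⁻ p, ENNReal.ofReal
        (whiteGaussianPDF D (p.1 - g (f p.1 + p.2)) * whiteGaussianPDF T (f p.1 + p.2)
          / (whiteGaussianPDF v p.1 * whiteGaussianPDF 1 p.2))
      ∂(whiteGaussian m v).prod (whiteGaussian m 1) = 1 := by
  have hφ := fun w : ℝ≥0 => measurable_whiteGaussianPDF (m := m) w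
  have hmeas : Measurable fun p : (Fin m → ℝ) × (Fin m → ℝ) => ENNReal.ofReal
      (whiteGaussianPDF D (p.1 - g (f p.1 + p.2)) * whiteGaussianPDF T (f p.1 + p.2)
        / (whiteGaussianPDF v p.1 * whiteGaussianPDF 1 p.2)) := by
    fun_prop
  have hmeas' : Measurable fun p : (Fin m → ℝ) × (Fin m → ℝ) => ENNReal.ofReal
      (whiteGaussianPDF D (p.1 - g p.2) * whiteGaussianPDF T p.2) := by
    fun_prop
  rw [lintegral_prod _ hmeas.aemeasurable,
    lintegral_whiteGaussian hv hmeas.lintegral_prod_right']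
  calc
    _ = ∫⁻ x : Fin m → ℝ, ∫⁻ y : Fin m → ℝ,
          ENNReal.ofReal (whiteGaussianPDF D (x - g y) * whiteGaussianPDF T y) := by
      refine lintegral_congr fun x => ?_
      -- For fixed x, the substitution y = f x + z preserves Lebesgue measure, and the Gaussian
      -- densities cancel the denominator.
      rw [lintegral_whiteGaussian one_ne_zero (by fun_prop),
        ← lintegral_const_mul' _ _ ENNReal.ofReal_ne_top,
        ← lintegral_add_left_eq_self (fun y => ENNReal.ofReal
          (whiteGaussianPDF D (x - g y) * whiteGaussianPDF T y)) (f x)]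
      refine lintegral_congr fun z => ?_
      have h1 := whiteGaussianPDF_pos hv x
      have h2 := whiteGaussianPDF_pos one_ne_zero z
      rw [← ENNReal.ofReal_mul h2.le, ← ENNReal.ofReal_mul h1.le]
      congr 1
      field_simp
    _ = ∫⁻ y : Fin m → ℝ, ∫⁻ x : Fin m → ℝ,
          ENNReal.ofReal (whiteGaussianPDF D (x - g y) * whiteGaussianPDF T y) :=
      lintegral_lintegral_swap hmeas'.aemeasurable
    _ = ∫⁻ y : Fin m → ℝ, ENNReal.ofReal (whiteGaussianPDF T y) := by
      refine lintegral_congr fun y => ?_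
      -- For fixed y the shift by g y is a constant, so translation invariance removes it.
      simp only [ENNReal.ofReal_mul' (whiteGaussianPDF_pos hT y).le]
      rw [lintegral_mul_const' _ _ ENNReal.ofReal_ne_top,
        lintegral_sub_right_eq_self (fun x => ENNReal.ofReal (whiteGaussianPDF D x)) (g y),
        lintegral_whiteGaussianPDF hD, one_mul]
    _ = 1 := lintegral_whiteGaussianPDF hT

/-- Gibbs inequality: if `exp h` has mean at most one, then `h` has mean at most zero. -/
theorem integral_nonpos_of_lintegral_exp_le_one {Ω : Type*} [MeasurableSpace Ω] {μ : Measure Ω}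
    [IsProbabilityMeasure μ] {h : Ω → ℝ} (hh : Integrable h μ)
    (hexp : ∫⁻ ω, ENNReal.ofReal (Real.exp (h ω)) ∂μ ≤ 1) : ∫ ω, h ω ∂μ ≤ 0 := by
  have hpos : ∀ᵐ ω ∂μ, 0 ≤ Real.exp (h ω) := Eventually.of_forall fun ω => (Real.exp_pos _).le
  have hae : AEStronglyMeasurable (fun ω => Real.exp (h ω)) μ :=
    Real.continuous_exp.comp_aestronglyMeasurable hh.aestronglyMeasurable
  have hint : Integrable (fun ω => Real.exp (h ω)) μ :=
    ⟨hae, by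
      rw [hasFiniteIntegral_iff_ofReal hpos]; exact hexp.trans_lt ENNReal.one_lt_top⟩
  have hle : ∫ ω, Real.exp (h ω) ∂μ ≤ 1 := by
    rw [integral_eq_lintegral_of_nonneg_ae hpos hae]
    exact ENNReal.toReal_le_of_le_ofReal zero_le_one (by simpa using hexp)
  have hmono : ∫ ω, h ω ∂μ ≤ ∫ ω, (Real.exp (h ω) - 1) ∂μ :=
    integral_mono hh (hint.sub (integrable_const 1)) fun ω => by
      have := Real.add_one_le_exp (h ω)
      show h ω ≤ Real.exp (h ω) - 1
      linarith
  rw [integral_sub hint (integrable_const 1)] at hmono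
  simp only [integral_const, probReal_univ, smul_eq_mul, mul_one] at hmono
  linarith

/-- Source-channel converse: an estimate, from the output of an additive white Gaussian noise
channel of output power at most `T`, of a white Gaussian source of variance `v` has mean squared
error at least `v / T` per coordinate. -/
theorem variance_div_le_integral_sum_sq_sub (hm : 1 ≤ m) {f g : (Fin m → ℝ) → Fin m → ℝ}
    (hf : Measurable f) (hg : Measurable g) {v T : ℝ≥0} (hv : v ≠ 0) (hT : T ≠ 0)
    (hY : ∀ i, MemLp (fun p : (Fin m → ℝ) × (Fin m → ℝ) => (f p.1 + p.2) i) 2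
      ((whiteGaussian m v).prod (whiteGaussian m 1)))
    (hYT : ∫ p, ∑ i, (f p.1 + p.2) i ^ 2 ∂(whiteGaussian m v).prod (whiteGaussian m 1) ≤ m * T)
    (hE : ∀ i, MemLp (fun p : (Fin m → ℝ) × (Fin m → ℝ) => (p.1 - g (f p.1 + p.2)) i) 2
      ((whiteGaussian m v).prod (whiteGaussian m 1))) :
    (v / T : ℝ) ≤ (∫ p, ∑ i, (p.1 - g (f p.1 + p.2)) i ^ 2
      ∂(whiteGaussian m v).prod (whiteGaussian m 1)) / m := by
  set μ := (whiteGaussian m v).prod (whiteGaussian m 1) with hμ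
  set A := ∫ p, ∑ i, (p.1 - g (f p.1 + p.2)) i ^ 2 ∂μ with hA
  have hm0 : (0 : ℝ) < m := by exact_mod_cast hm
  have hA0 : 0 ≤ A := integral_sum_sq_nonneg fun p : (Fin m → ℝ) × (Fin m → ℝ) =>
    p.1 - g (f p.1 + p.2)
  -- The test channel needs positive variance, while the error might a priori be 0; hence an
  -- arbitrary d strictly above it.
  refine le_of_forall_gt_imp_ge_of_dense fun d hd => ?_
  have hd0 : 0 < d := (div_nonneg hA0 hm0.le).trans_lt hd
  lift d to ℝ≥0 using hd0.le
  have hD : d ≠ 0 := by rintro rfl; simp at hd0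
  have hv0 : (0 : ℝ) < v := by positivity
  have hT0 : (0 : ℝ) < T := by positivity
  have hX : ∀ i, MemLp (fun p : (Fin m → ℝ) × (Fin m → ℝ) => p.1 i) 2 μ := fun i =>
    (memLp_eval_whiteGaussian v i).comp_fst (whiteGaussian m 1)
  have hZ : ∀ i, MemLp (fun p : (Fin m → ℝ) × (Fin m → ℝ) => p.2 i) 2 μ := fun i =>
    (memLp_eval_whiteGaussian 1 i).comp_snd (whiteGaussian m v)
  have hXv : ∫ p, ∑ i, p.1 i ^ 2 ∂μ = m * v := by
    rw [hμ, integral_fun_fst (fun x : Fin m → ℝ => ∑ i, x i ^ 2), integral_sum_sq_whiteGaussian]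
    simp
  have hZv : ∫ p, ∑ i, p.2 i ^ 2 ∂μ = m := by
    rw [hμ, integral_fun_snd (fun x : Fin m → ℝ => ∑ i, x i ^ 2), integral_sum_sq_whiteGaussian]
    simp
  -- The constant part of the log density ratio; the factors 2π cancel.
  set c : ℝ := m / 2 * (Real.log v - Real.log d - Real.log T) with hc
  have hI1 := (integrable_sum_sq hE).div_const (2 * d)
  have hI2 := (integrable_sum_sq hY).div_const (2 * T)
  have hI3 := (integrable_sum_sq hX).div_const (2 * v)
  have hI4 := (integrable_sum_sq hZ).div_const 2
  have hI12 := (hI1.add hI2)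
  have hI34 := (hI3.add hI4)
  have hI : Integrable (fun p : (Fin m → ℝ) × (Fin m → ℝ) =>
      (c + ((∑ i, p.1 i ^ 2) / (2 * v) + (∑ i, p.2 i ^ 2) / 2))
        - ((∑ i, (p.1 - g (f p.1 + p.2)) i ^ 2) / (2 * d)
        + (∑ i, (f p.1 + p.2) i ^ 2) / (2 * T))) μ :=
    ((integrable_const c).add hI34).sub hI12
  have hle := integral_nonpos_of_lintegral_exp_le_one hI (by
    rw [← lintegral_backward_density_ratio hf hg hv hD hT]
    refine le_of_eq (lintegral_congr fun p => ?_)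
    have h1 := whiteGaussianPDF_pos hD (p.1 - g (f p.1 + p.2))
    have h2 := whiteGaussianPDF_pos hT (f p.1 + p.2)
    have h3 := whiteGaussianPDF_pos hv p.1
    have h4 := whiteGaussianPDF_pos one_ne_zero p.2
    rw [← Real.exp_log (div_pos (mul_pos h1 h2) (mul_pos h3 h4)),
      Real.log_div (mul_pos h1 h2).ne' (mul_pos h3 h4).ne', Real.log_mul h1.ne' h2.ne',
      Real.log_mul h3.ne' h4.ne', log_whiteGaussianPDF hD, log_whiteGaussianPDF hT,
      log_whiteGaussianPDF hv, log_whiteGaussianPDF one_ne_zero]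
    have hpi : (2 * Real.pi) ≠ 0 := by positivity
    rw [Real.log_mul hpi hd0.ne', Real.log_mul hpi hv0.ne', Real.log_mul hpi hT0.ne', hc]
    congr 2
    push_cast
    ring_nf)
  have hval : ∫ p : (Fin m → ℝ) × (Fin m → ℝ),
      ((c + ((∑ i, p.1 i ^ 2) / (2 * v) + (∑ i, p.2 i ^ 2) / 2))
        - ((∑ i, (p.1 - g (f p.1 + p.2)) i ^ 2) / (2 * d)
        + (∑ i, (f p.1 + p.2) i ^ 2) / (2 * T))) ∂μ
      = (c + (m * v / (2 * v) + m / 2))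
        - (A / (2 * d) + (∫ p, ∑ i, (f p.1 + p.2) i ^ 2 ∂μ) / (2 * T)) := by
    rw [integral_sub (by exact (integrable_const c).add hI34) (by exact hI12),
      integral_add (integrable_const c) (by exact hI34), integral_add hI3 hI4,
      integral_add hI1 hI2]
    simp only [integral_div, integral_const, probReal_univ, one_smul, hXv, hZv, hA]
  rw [hval] at hle
  -- Source and noise contribute m/2 each; error and output, entering with a minus sign, at most m/2
  -- each. Only c ≤ 0 survives.
  have e1 : (m * v / (2 * v) : ℝ) = m / 2 := by field_simp
  have e2 : A / (2 * d) ≤ m / 2 := by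
    rw [div_lt_iff₀ hm0] at hd
    rw [div_le_div_iff₀ (by positivity) two_pos]
    linarith
  have e3 : (∫ p, ∑ i, (f p.1 + p.2) i ^ 2 ∂μ) / (2 * T) ≤ m / 2 := by
    rw [div_le_div_iff₀ (by positivity) two_pos]
    linarith
  have hc0 : c ≤ 0 := by linarith
  have hlog : Real.log v ≤ Real.log (d * T) := by
    rw [Real.log_mul hd0.ne' hT0.ne']
    by_contra hcon
    push Not at hcon
    have : 0 < c := mul_pos (by positivity) (by linarith)
    linarith
  rw [div_le_iff₀ hT0]
  exact (Real.log_le_log_iff hv0 (by positivity)).1 hlog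

end Converse

-- From the converse to codes.

section Codes

variable {m : ℕ}

theorem numMessages_zero (m : ℕ) : numMessages m 0 = 1 := by
  simp [numMessages]

theorem measurable_sqDist {α : Type*} [MeasurableSpace α] {u v : α → Fin m → ℝ}
    (hu : Measurable u) (hv : Measurable v) : Measurable fun a => sqDist (u a) (v a) := by
  unfold sqDist
  fun_prop

/-- With a single message, the distortion is an integral over the host signal and the noise. -/
theorem Code.distortion_one (c : Code m 1) (σ : ℝ≥0) :
    c.distortion σ = (∫⁻ p, ENNReal.ofReal
        (sqDist (c.encode 0 p.1) (c.decodeHost (c.encode 0 p.1 + p.2)))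
      ∂(whiteGaussian m (σ ^ 2)).prod (whiteGaussian m 1)) / m := by
  have he := c.measurable_encode 0
  have hg := c.measurable_decodeHost
  have hmeas : Measurable fun ω : Fin 1 × (Fin m → ℝ) × (Fin m → ℝ) =>
      ENNReal.ofReal (sqDist (c.modifiedHost ω) (c.decodeHost (c.channelOutput ω))) := by
    have h1 : Measurable c.modifiedHost := by
      have h : c.modifiedHost = fun ω => c.encode 0 ω.2.1 :=
        funext fun ω => by rw [Code.modifiedHost, Subsingleton.elim ω.1 0]
      rw [h]
      fun_prop
    have h2 : Measurable c.channelOutput := by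
      unfold Code.channelOutput
      fun_prop
    exact (measurable_sqDist h1 (hg.comp h2)).ennreal_ofReal
  rw [Code.distortion, sourceLaw, lintegral_prod _ hmeas.aemeasurable, lintegral_unique,
    measure_univ, mul_one]
  rfl

/-- Power of the channel output for an encoder of finite power. -/
theorem integral_sum_sq_channelOutput {v : ℝ≥0} {f : (Fin m → ℝ) → Fin m → ℝ}
    (hf : ∀ i, MemLp (fun x => f x i) 2 (whiteGaussian m v)) :
    ∫ p, ∑ i, (f p.1 + p.2) i ^ 2 ∂(whiteGaussian m v).prod (whiteGaussian m 1)
      = ∫ x, ∑ i, f x i ^ 2 ∂whiteGaussian m v + m := by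
  have hF : ∀ i, MemLp (fun p : (Fin m → ℝ) × (Fin m → ℝ) => f p.1 i) 2
      ((whiteGaussian m v).prod (whiteGaussian m 1)) := fun i => (hf i).comp_fst _
  have hZ : ∀ i, MemLp (fun p : (Fin m → ℝ) × (Fin m → ℝ) => p.2 i) 2
      ((whiteGaussian m v).prod (whiteGaussian m 1)) :=
    fun i => (memLp_eval_whiteGaussian 1 i).comp_snd _
  have hcross : ∫ p, ∑ i, f p.1 i * p.2 i ∂(whiteGaussian m v).prod (whiteGaussian m 1) = 0 := by
    rw [integral_finsetSum _ fun i _ => by exact (hF i).integrable_mul (hZ i)]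
    refine Finset.sum_eq_zero fun i _ => ?_
    rw [integral_prod_mul (fun x => f x i) (fun z : Fin m → ℝ => z i),
      integral_eval_whiteGaussian, mul_zero]
  have h := integral_sum_sq_linComb hF hZ 1 1
  rw [hcross, integral_fun_fst (fun x : Fin m → ℝ => ∑ i, f x i ^ 2),
    integral_fun_snd (fun x : Fin m → ℝ => ∑ i, x i ^ 2), integral_sum_sq_whiteGaussian] at h
  simpa using h

/-- Since |γ|√B is nonnegative, it also bounds the positive part; then square and divide by γ². -/
theorem boundTerm_le_of_sqrt_le {σ P : ℝ≥0} {s γ B : ℝ} (hγ : γ ≠ 0) (hB : 0 ≤ B)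
    (h : √((σ : ℝ) ^ 2 / (1 + (σ : ℝ) ^ 2 + P + 2 * s))
      ≤ √((1 - γ) ^ 2 * (σ : ℝ) ^ 2 + γ ^ 2 * P - 2 * γ * (1 - γ) * s) + |γ| * √B) :
    boundTerm σ P s γ ≤ B := by
  have hmax : max (√((σ : ℝ) ^ 2 / (1 + (σ : ℝ) ^ 2 + P + 2 * s))
      - √((1 - γ) ^ 2 * (σ : ℝ) ^ 2 + γ ^ 2 * P - 2 * γ * (1 - γ) * s)) 0 ≤ |γ| * √B :=
    max_le (by linarith) (by positivity)
  have hsq := pow_le_pow_left₀ (le_max_right _ _) hmax 2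
  rw [mul_pow, sq_abs, Real.sq_sqrt hB] at hsq
  have hγ2 : 0 < γ ^ 2 := by positivity
  rw [boundTerm, one_div, inv_mul_le_iff₀ hγ2]
  exact hsq

/-- The lower bound for a single encoder-decoder pair, in terms of the normalized correlation of
the host signal and the encoder's input. -/
theorem lowerBound_le_of_memLp (hm : 1 ≤ m) {σ P : ℝ≥0} (hσ : σ ≠ 0)
    {f g : (Fin m → ℝ) → Fin m → ℝ} (hf : Measurable f) (hg : Measurable g)
    (hV : ∀ i, MemLp (fun x => x i - f x i) 2 (whiteGaussian m (σ ^ 2)))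
    (hVP : ∫ x, ∑ i, (x i - f x i) ^ 2 ∂whiteGaussian m (σ ^ 2) ≤ m * P)
    (hE : ∀ i, MemLp (fun p : (Fin m → ℝ) × (Fin m → ℝ) => f p.1 i - g (f p.1 + p.2) i) 2
      ((whiteGaussian m (σ ^ 2)).prod (whiteGaussian m 1))) :
    lowerBound σ P ≤ ENNReal.ofReal ((∫ p, ∑ i, (f p.1 i - g (f p.1 + p.2) i) ^ 2
      ∂(whiteGaussian m (σ ^ 2)).prod (whiteGaussian m 1)) / m) := by
  set ν := whiteGaussian m (σ ^ 2) with hν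
  set μ := ν.prod (whiteGaussian m 1) with hμ
  set B := ∫ p, ∑ i, (f p.1 i - g (f p.1 + p.2) i) ^ 2 ∂μ with hB
  set Q := ∫ x, ∑ i, (x i - f x i) ^ 2 ∂ν with hQ
  set K := ∫ x, ∑ i, x i * (x i - f x i) ∂ν with hK
  have hm0 : (0 : ℝ) < m := by exact_mod_cast hm
  have hσ0 : (0 : ℝ) < σ := by positivity
  have hX : ∀ i, MemLp (fun x : Fin m → ℝ => x i) 2 ν := memLp_eval_whiteGaussian (σ ^ 2)
  have hXm : ∫ x, ∑ i, x i ^ 2 ∂ν = m * (σ : ℝ) ^ 2 := by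
    rw [hν, integral_sum_sq_whiteGaussian]; push_cast; rfl
  have hB0 : 0 ≤ B := integral_sum_sq_nonneg fun (p : (Fin m → ℝ) × (Fin m → ℝ)) i =>
    f p.1 i - g (f p.1 + p.2) i
  -- The minus sign appears because V = X₁ - X₀, whereas K pairs X₀ with X₀ - X₁.
  have hs : |-K / m| ≤ σ * √(P : ℝ) := by
    rw [← Real.sqrt_sq hσ0.le, ← Real.sqrt_mul (sq_nonneg _)]
    refine Real.abs_le_sqrt ?_
    have hcs := sq_integral_sum_mul_le hX hV
    rw [hXm, ← hK, ← hQ] at hcs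
    rw [div_pow, div_le_iff₀ (by positivity), neg_sq]
    calc K ^ 2 ≤ m * (σ : ℝ) ^ 2 * Q := hcs
      _ ≤ m * (σ : ℝ) ^ 2 * (m * P) := by gcongr
      _ = (σ : ℝ) ^ 2 * P * (m : ℝ) ^ 2 := by ring
  refine (iInf₂_le (-K / m) hs).trans (iSup₂_le fun γ hγ => ENNReal.ofReal_le_ofReal ?_)
  refine boundTerm_le_of_sqrt_le hγ (by positivity) ?_
  set s : ℝ := -K / m with hsdef
  have hKs : K = -(m * s) := by rw [hsdef]; field_simp
  -- the output power
  have hT0 : 0 < 1 + (σ : ℝ) ^ 2 + P + 2 * s := by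
    -- As s ≥ -σ√P, the quantity is at least 1 + (σ - √P)².
    have h1 := (abs_le.1 hs).1
    have h2 := Real.sq_sqrt P.coe_nonneg
    nlinarith [sq_nonneg ((σ : ℝ) - √(P : ℝ))]
  have hfL : ∀ i, MemLp (fun x => f x i) 2 ν := fun i => by
    have h : MemLp (fun x : Fin m → ℝ => x i - (x i - f x i)) 2 ν := (hX i).sub (hV i)
    simpa only [sub_sub_cancel] using h
  have hfm : ∫ x, ∑ i, f x i ^ 2 ∂ν ≤ m * ((σ : ℝ) ^ 2 + P + 2 * s) := by
    have h := integral_sum_sq_linComb hX hV 1 (-1)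
    simp only [one_mul, neg_one_mul, ← sub_eq_add_neg, sub_sub_cancel] at h
    rw [h, hXm, ← hK, ← hQ, hKs]
    linarith
  have hY : ∀ i, MemLp (fun p : (Fin m → ℝ) × (Fin m → ℝ) => (f p.1 + p.2) i) 2 μ := fun i =>
    ((hfL i).comp_fst (whiteGaussian m 1)).add ((memLp_eval_whiteGaussian 1 i).comp_snd ν)
  have hYm := integral_sum_sq_channelOutput hfL
  -- the error of `γ X̂₁` as an estimate of the host signal
  have hU : ∀ i, MemLp (fun x : Fin m → ℝ => (1 - γ) * x i + γ * (x i - f x i)) 2 ν := fun i =>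
    ((hX i).const_mul (1 - γ)).add ((hV i).const_mul γ)
  have hUm : ∫ x, ∑ i, ((1 - γ) * x i + γ * (x i - f x i)) ^ 2 ∂ν
      ≤ m * ((1 - γ) ^ 2 * (σ : ℝ) ^ 2 + γ ^ 2 * P - 2 * γ * (1 - γ) * s) := by
    rw [integral_sum_sq_linComb hX hV, hXm, ← hK, ← hQ, hKs]
    have := mul_le_mul_of_nonneg_left hVP (sq_nonneg γ)
    linarith
  have hU' : ∀ i, MemLp (fun p : (Fin m → ℝ) × (Fin m → ℝ) =>
      (1 - γ) * p.1 i + γ * (p.1 i - f p.1 i)) 2 μ :=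
    fun i => (hU i).comp_fst (whiteGaussian m 1)
  have hUm' : ∫ p, ∑ i, ((1 - γ) * p.1 i + γ * (p.1 i - f p.1 i)) ^ 2 ∂μ
      = ∫ x, ∑ i, ((1 - γ) * x i + γ * (x i - f x i)) ^ 2 ∂ν := by
    rw [hμ, integral_fun_fst (fun x : Fin m → ℝ => ∑ i, ((1 - γ) * x i + γ * (x i - f x i)) ^ 2)]
    simp
  have hsplit : ∀ (p : (Fin m → ℝ) × (Fin m → ℝ)) (i : Fin m),
      (p.1 - (γ • g) (f p.1 + p.2)) i = 1 * ((1 - γ) * p.1 i + γ * (p.1 i - f p.1 i))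
        + γ * (f p.1 i - g (f p.1 + p.2) i) := fun p i => by
    simp only [Pi.sub_apply, Pi.smul_apply, smul_eq_mul]
    ring
  have hErr : ∀ i, MemLp (fun p : (Fin m → ℝ) × (Fin m → ℝ) =>
      (p.1 - (γ • g) (f p.1 + p.2)) i) 2 μ := fun i => by
    simp only [hsplit]
    exact ((hU' i).const_mul 1).add ((hE i).const_mul γ)
  obtain ⟨T, hT⟩ : ∃ T : ℝ≥0, (T : ℝ) = 1 + (σ : ℝ) ^ 2 + P + 2 * s :=
    ⟨_, Real.coe_toNNReal _ hT0.le⟩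
  have hconv := variance_div_le_integral_sum_sq_sub (T := T) hm hf (hg.const_smul γ)
    (pow_ne_zero 2 hσ) (fun h => hT0.ne' (by rw [← hT, h, NNReal.coe_zero])) hY
    (by rw [hYm, hT]; linarith) hErr
  have hmink := sqrt_integral_sum_sq_linComb_le hU' hE γ
  simp only [← hsplit] at hmink
  rw [hUm'] at hmink
  rw [NNReal.coe_pow, hT] at hconv
  refine (Real.sqrt_le_sqrt hconv).trans ?_
  rw [Real.sqrt_div' _ hm0.le, Real.sqrt_div' _ hm0.le, div_le_iff₀ (Real.sqrt_pos.2 hm0)]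
  refine hmink.trans ?_
  rw [add_mul, mul_assoc |γ|, div_mul_cancel₀ _ (Real.sqrt_pos.2 hm0).ne']
  gcongr
  rw [← Real.sqrt_mul' _ hm0.le, mul_comm _ (m : ℝ)]
  exact Real.sqrt_le_sqrt hUm

theorem lowerBound_zero_left (P : ℝ≥0) : lowerBound 0 P = 0 := by
  refine le_antisymm ((iInf₂_le 0 (by simp)).trans (iSup₂_le fun γ _ => ?_)) bot_le
  have h : boundTerm 0 P 0 γ = 0 := by
    simp [boundTerm, mul_nonneg, Real.sqrt_nonneg]
  simp [h]

theorem lowerBound_le_distortion (hm : 1 ≤ m) {σ P : ℝ≥0} (c : Code m 1)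
    (hc : c.PowerConstraint σ P) : lowerBound σ P ≤ c.distortion σ := by
  -- A degenerate host has no density, but then the bound is trivial.
  rcases eq_or_ne σ 0 with rfl | hσ
  · rw [lowerBound_zero_left]; exact bot_le
  have he := c.measurable_encode 0
  have hg := c.measurable_decodeHost
  have hm0 : (0 : ℝ) < m := by exact_mod_cast hm
  rw [Code.distortion_one]
  by_cases htop : ∫⁻ p, ENNReal.ofReal
      (sqDist (c.encode 0 p.1) (c.decodeHost (c.encode 0 p.1 + p.2)))
      ∂(whiteGaussian m (σ ^ 2)).prod (whiteGaussian m 1) = ∞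
  · rw [htop, ENNReal.top_div_of_ne_top (ENNReal.natCast_ne_top m)]
    exact le_top
  have hP := hc 0
  have hV := memLp_two_of_lintegral_ne_top (u := fun x i => x i - c.encode 0 x i) (by fun_prop)
    (ne_top_of_le_ne_top (ENNReal.mul_ne_top (ENNReal.natCast_ne_top m) ENNReal.coe_ne_top) hP)
  have hE := memLp_two_of_lintegral_ne_top
    (u := fun (p : (Fin m → ℝ) × (Fin m → ℝ)) i =>
      c.encode 0 p.1 i - c.decodeHost (c.encode 0 p.1 + p.2) i) (by fun_prop) htop
  have hVP : ∫ x, ∑ i, (x i - c.encode 0 x i) ^ 2 ∂whiteGaussian m (σ ^ 2) ≤ m * P := by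
    refine (ENNReal.ofReal_le_ofReal_iff (by positivity)).1 ?_
    rw [ofReal_integral_eq_lintegral_ofReal (integrable_sum_sq hV)
      (Eventually.of_forall fun x => Finset.sum_nonneg fun i _ => sq_nonneg _),
      ENNReal.ofReal_mul hm0.le, ENNReal.ofReal_natCast, ENNReal.ofReal_coe_nnreal]
    exact hP
  refine (lowerBound_le_of_memLp hm hσ he hg hV hVP hE).trans (le_of_eq ?_)
  rw [ENNReal.ofReal_div_of_pos hm0, ENNReal.ofReal_natCast,
    ofReal_integral_eq_lintegral_ofReal (integrable_sum_sq hE)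
      (Eventually.of_forall fun x => Finset.sum_nonneg fun i _ => sq_nonneg _)]
  rfl

end Codes

end InfoEmbedding

end

theorem corollary1 (σ P : ℝ≥0) :
    InfoEmbedding.lowerBound σ P ≤ InfoEmbedding.MMSE σ P 0 ∧
    ∀ (m : ℕ), 1 ≤ m → ∀ c : InfoEmbedding.Code m (InfoEmbedding.numMessages m 0),
      c.PowerConstraint σ P → InfoEmbedding.lowerBound σ P ≤ c.distortion σ := by
  have key : ∀ (m : ℕ), 1 ≤ m → ∀ c : InfoEmbedding.Code m (InfoEmbedding.numMessages m 0),
      c.PowerConstraint σ P → InfoEmbedding.lowerBound σ P ≤ c.distortion σ := by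
    intro m hm
    rw [InfoEmbedding.numMessages_zero]
    exact fun c hc => InfoEmbedding.lowerBound_le_distortion hm c hc
  refine ⟨?_, key⟩
  refine le_iInf fun c => le_iInf fun hc => le_iInf fun _ => ?_
  refine le_trans ?_ (liminf_le_limsup (f := atTop))
  -- The bound is only needed eventually, which discards m = 0, where the distortion is 0/0 = 0.
  refine le_liminf_of_le (by isBoundedDefault) ?_
  filter_upwards [eventually_ge_atTop 1] with m hm
  exact key m hm (c m) (hc m)
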